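/- **Proposition (Area law).** Let $G$ be a finite connected simple graph with vertex set $V$ (the lattice), with a spin-$1/2$ particle, i.e. a copy of $\mathbb{C}^2$, at every vertex. For every edge $e=\{a,b\}$ of $G$ let $h_e$ be a Hermitian operator on the two spins $a,b$, and let $H=\sum_e h_e\otimes 1$ on $(\mathbb{C}^2)^{\otimes V}$. The ground space of a Hermitian operator is the eigenspace of its smallest eigenvalue. Assume that $H$ is *natural*: for every edge $e$ there is an entangled (i.e. non-product) vector in $\mathbb{C}^2\otimes\mathbb{C}^2$ orthogonal to the ground space of $h_e$; and *unfrustrated*: every vector in the ground space $M$ of $H$ lies in the ground space of $h_e\otimes 1$ for every $e$. Let $\rho=P_M/\dim M$ be the maximally mixed state over $M$. For $A\subseteq V$ let $\partial A$ be the set of edges between $A$ and $V\setminus A$, and let $\alpha(A)$ be the number of vertices of $A$ that are adjacent to a vertex outside $A$. The lattice is of finite dimension with constants $c,K>0$ if $\alpha(A)\ge K|A|^c$ for every non-empty $A\subseteq V$ which induces a connected subgraph and has $|A|\le |V|/2$. The entanglement of formation of $\rho$ across $A:V\setminus A$ is $$E_F(\rho)=\inf\Big\{\sum_i p_i\,S\big(\mathrm{Tr}_{V\setminus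 A}|\psi_i\rangle\langle\psi_i|\big)\ :\ \rho=\sum_i p_i|\psi_i\rangle\langle\psi_i|\Big\},$$ where the infimum is over finite ensembles of unit vectors $\psi_i$ with probabilities $p_i$, and $S(\sigma)=-\mathrm{Tr}\,\sigma\log_2\sigma$. For all $c,K>0$ there is a constant $C>0$, depending only on $c$ and $K$ (in particular, neither on the size of the lattice, nor on $H$, nor on $A$), such that for every lattice $G$ of finite dimension with constants $c,K$, every unfrustrated natural Hamiltonian $H$ on $G$, and every subsystem $A\subseteq V$, $$E_F(\rho)\le C\,|\partial A| .$$ -/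

import Mathlib

open scoped Matrix

noncomputable section

namespace SpinLattice

/-! ### Linear algebra: ground spaces, states, entanglement of formation -/

/-- The Hilbert space `(ℂ²)^{⊗ S}` of a finite set `S` of spin-1/2 particles, written in the
computational basis (which is indexed by the configurations `S → {0,1}`). -/
abbrev SpinSpace (S : Type*) [Fintype S] := EuclideanSpace ℂ (S → Fin 2)

/-- Operators on `(ℂ²)^{⊗ S}`, as matrices in the computational basis. -/
abbrev SpinOp (S : Type*) := Matrix (S → Fin 2) (S → Fin 2) ℂ

/-- The ground energy of a Hermitian matrix: its smallest eigenvalue. -/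
def groundEnergy {n : Type*} [Fintype n] [DecidableEq n] (X : Matrix n n ℂ) : ℝ :=
  sInf (spectrum ℝ X)

/-- The ground-state manifold of a Hermitian matrix: the eigenspace of the smallest eigenvalue. -/
def groundSpace {n : Type*} [Fintype n] [DecidableEq n] (X : Matrix n n ℂ) :
    Submodule ℂ (EuclideanSpace ℂ n) :=
  Module.End.eigenspace (Matrix.toEuclideanLin X) (groundEnergy X : ℂ)

/-- The maximally mixed state `P_M / dim M` over a subspace `M`. -/
def maximallyMixed {n : Type*} [Fintype n] [DecidableEq n]
    (M : Submodule ℂ (EuclideanSpace ℂ n)) : Matrix n n ℂ :=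
  (Module.finrank ℂ M : ℂ)⁻¹ •
    Matrix.toEuclideanLin.symm (M.starProjection : EuclideanSpace ℂ n →ₗ[ℂ] EuclideanSpace ℂ n)

/-- The rank-one operator `|ψ⟩⟨ψ|`. -/
def pureState {n : Type*} (ψ : EuclideanSpace ℂ n) : Matrix n n ℂ :=
  Matrix.of fun x y => ψ x * star (ψ y)

/-- A vector is a product vector if it is of the form `⨂_v f_v`; otherwise it is entangled. -/
def IsProductVector {S : Type*} [Fintype S] (φ : SpinSpace S) : Prop :=
  ∃ f : S → Fin 2 → ℂ, ∀ x : S → Fin 2, φ x = ∏ v, f v (x v)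

/-- The von Neumann entropy `-Tr σ log₂ σ` of a Hermitian matrix, in e-bits. -/
def vonNeumannEntropy {n : Type*} [Fintype n] [DecidableEq n] {σ : Matrix n n ℂ}
    (hσ : σ.IsHermitian) : ℝ :=
  ∑ i, -(hσ.eigenvalues i * Real.logb 2 (hσ.eigenvalues i))

section Bipartite

variable {V : Type*} [Fintype V] [DecidableEq V]

/-- The coefficients of a vector `ψ ∈ (ℂ²)^{⊗ V}` as a matrix whose rows are the configurations
of `A` and whose columns are the configurations of `V ∖ A`. -/
def coeffMatrix (A : Finset V) (ψ : SpinSpace V) :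
    Matrix ({v // v ∈ A} → Fin 2) ({v // v ∉ A} → Fin 2) ℂ :=
  Matrix.of fun x y => ψ ((Equiv.piEquivPiSubtypeProd (· ∈ A) (fun _ => Fin 2)).symm (x, y))

/-- The reduced state `Tr_{V∖A} |ψ⟩⟨ψ|`: its entry at `(x, x')` is
`∑ y, ψ (x, y) * conj (ψ (x', y))`. -/
def reducedState (A : Finset V) (ψ : SpinSpace V) : SpinOp {v // v ∈ A} :=
  coeffMatrix A ψ * (coeffMatrix A ψ)ᴴ

theorem reducedState_isHermitian (A : Finset V) (ψ : SpinSpace V) :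
    (reducedState A ψ).IsHermitian :=
  Matrix.isHermitian_mul_conjTranspose_self _

/-- The entropy of entanglement of a pure state across `A : V ∖ A`. -/
def entanglementEntropy (A : Finset V) (ψ : SpinSpace V) : ℝ :=
  vonNeumannEntropy (reducedState_isHermitian A ψ)

/-- A finite ensemble of pure states that realizes the mixed state `ρ`. -/
structure PureEnsemble (ρ : SpinOp V) where
  /-- the number of members -/
  size : ℕ
  /-- the probabilities -/
  prob : Fin size → ℝ
  /-- the state vectors -/
  vec : Fin size → SpinSpace V
  prob_nonneg : ∀ i, 0 ≤ prob i
  sum_prob : ∑ i, prob i = 1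
  norm_vec : ∀ i, ‖vec i‖ = 1
  mixture : ∑ i, (prob i : ℂ) • pureState (vec i) = ρ

/-- The entanglement of formation of `ρ` across `A : V ∖ A`: the infimum, over all pure-state
ensembles that realize `ρ`, of the average entropy of entanglement (`⊤` if there is no ensemble,
that is, if `ρ` is not a density matrix). -/
def entanglementOfFormation (A : Finset V) (ρ : SpinOp V) : EReal :=
  ⨅ e : PureEnsemble ρ, ((∑ i, e.prob i * entanglementEntropy A (e.vec i) : ℝ) : EReal)

end Bipartite

/-! ### Hamiltonians with nearest-neighbour terms -/

section Hamiltonian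

variable {V : Type*} [Fintype V] [DecidableEq V]

/-- The operator `h ⊗ 1` on all spins, for an operator `h` on the two spins of the pair `e`. -/
def extendPair (e : Sym2 V) (h : SpinOp {v // v ∈ e}) : SpinOp V :=
  Matrix.of fun x y =>
    if ∀ v, v ∉ e → x v = y v then h (fun v => x v) (fun v => y v) else 0

/-- A 2-local spin-1/2 Hamiltonian `H = ∑ h_{a,b}` with interaction graph `G`: one Hermitian
two-spin term for every edge `{a,b}`. The ground energies of the terms need not be zero. -/
structure PairHamiltonian (G : SimpleGraph V) where
  /-- the term on the two spins of an edge -/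
  term : ∀ e : G.edgeSet, SpinOp {v // v ∈ (e : Sym2 V)}
  isHermitian : ∀ e, (term e).IsHermitian

namespace PairHamiltonian

variable {G : SimpleGraph V}

/-- The term of an edge as an operator on the whole system. -/
def globalTerm (H : PairHamiltonian G) (e : G.edgeSet) : SpinOp V :=
  extendPair (e : Sym2 V) (H.term e)

/-- The total Hamiltonian. -/
def total [DecidableRel G.Adj] (H : PairHamiltonian G) : SpinOp V :=
  ∑ e : G.edgeSet, H.globalTerm e

/-- Natural: there are no isolated subsystems (the interaction graph is connected), and each term
has an entangled excited state, i.e. an entangled vector orthogonal to its ground space. -/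
structure IsNatural (H : PairHamiltonian G) : Prop where
  connected : G.Connected
  entangled : ∀ e : G.edgeSet, ∃ φ ∈ (groundSpace (H.term e))ᗮ, ¬ IsProductVector φ

/-- Unfrustrated: every ground state vector of `H` is a ground state vector of every term. -/
def IsUnfrustrated [DecidableRel G.Adj] (H : PairHamiltonian G) : Prop :=
  ∀ e : G.edgeSet, groundSpace H.total ≤ groundSpace (H.globalTerm e)

/-- The ground state: the maximally mixed state over the ground-state manifold. -/
def groundState [DecidableRel G.Adj] (H : PairHamiltonian G) : SpinOp V :=
  maximallyMixed (groundSpace H.total)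

end PairHamiltonian

end Hamiltonian

/-! ### Lattices -/

section Lattice

variable {V : Type*} [Fintype V] [DecidableEq V] (G : SimpleGraph V) [DecidableRel G.Adj]

/-- The spins of `A` that are adjacent to spins outside `A`. -/
def boundarySpins (A : Finset V) : Finset V :=
  A.filter fun a => ∃ b, b ∉ A ∧ G.Adj a b

/-- `|∂A|`: the number of edges between `A` and its complement. -/
def boundaryArea (A : Finset V) : ℕ :=
  (G.interedges A Aᶜ).card

/-- The finite lattice `G` obeys the isoperimetric inequality of a finite-dimensional lattice with
constants `c` and `K`: a contiguous region of `n` spins that fills at most half of the system has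
at least `K * n ^ c` boundary spins. (Box-shaped pieces and tori of `ℤ^d`, `d ≥ 2`, obey it with
`c = (d - 1) / d` and `K` independent of their size.) -/
def IsoperimetricBound (c K : ℝ) : Prop :=
  ∀ A : Finset V, (G.induce (A : Set V)).Connected → 2 * A.card ≤ Fintype.card V →
    K * (A.card : ℝ) ^ c ≤ ((boundarySpins G A).card : ℝ)

end Lattice

end SpinLattice

end

namespace SpinLattice

section Isoperimetry

/-- Every non-empty set of vertices has a connected part without edges to the remainder. -/
theorem exists_connected_part {V : Type*} [DecidableEq V] (G : SimpleGraph V)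
    (S : Finset V) (hS : S.Nonempty) :
    ∃ T ⊆ S, T.Nonempty ∧ (G.induce (T : Set V)).Connected ∧
      ∀ a ∈ T, ∀ b ∈ S \ T, ¬ G.Adj a b := by
  classical
  obtain ⟨v, hv⟩ := hS
  let F := S.powerset.filter fun T : Finset V => (G.induce (T : Set V)).Connected
  have hF : F.Nonempty := by
    refine ⟨{v}, Finset.mem_filter.2 ⟨by simpa using hv, ?_⟩⟩
    rw [Finset.coe_singleton]
    exact SimpleGraph.Connected.mk (SimpleGraph.Preconnected.of_subsingleton)
  obtain ⟨T, hT, hmax⟩ := F.exists_max_image Finset.card hF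
  obtain ⟨hTS, hTc⟩ := Finset.mem_filter.1 hT
  rw [Finset.mem_powerset] at hTS
  have hTn : T.Nonempty := by
    obtain ⟨x⟩ := hTc.nonempty
    exact ⟨x, x.2⟩
  refine ⟨T, hTS, hTn, hTc, fun a ha b hb hab => ?_⟩
  obtain ⟨hbS, hbT⟩ := Finset.mem_sdiff.1 hb
  have hins : insert b T ∈ F := by
    refine Finset.mem_filter.2 ⟨Finset.mem_powerset.2 (Finset.insert_subset hbS hTS), ?_⟩
    have h := SimpleGraph.induce_union_connected (G := G) (s := {a, b}) (t := (T : Set V))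
      (SimpleGraph.induce_pair_connected_of_adj hab).preconnected hTc.preconnected ⟨a, by simp, ha⟩
    have e : ({a, b} : Set V) ∪ (T : Set V) = ((insert b T : Finset V) : Set V) := by
      ext x
      simp only [Set.mem_union, Set.mem_insert_iff, Set.mem_singleton_iff, Finset.mem_coe,
        Finset.mem_insert]
      constructor
      · rintro ((rfl | rfl) | h)
        · exact Or.inr ha
        · exact Or.inl rfl
        · exact Or.inr h
      · tauto
    rwa [e] at h
  have := hmax _ hins
  rw [Finset.card_insert_of_notMem hbT] at this
  omega

variable {V : Type*} [Fintype V] [DecidableEq V] (G : SimpleGraph V) [DecidableRel G.Adj]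

theorem card_boundarySpins_le_boundaryArea (A : Finset V) :
    (boundarySpins G A).card ≤ boundaryArea G A := by
  have h : boundarySpins G A ⊆ (G.interedges A Aᶜ).image Prod.fst := by
    intro a ha
    simp only [boundarySpins, Finset.mem_filter] at ha
    obtain ⟨haA, b, hb, hab⟩ := ha
    exact Finset.mem_image.2 ⟨(a, b), (SimpleGraph.mem_interedges_iff G).2
      ⟨haA, Finset.mem_compl.2 hb, hab⟩, rfl⟩
  exact (Finset.card_le_card h).trans Finset.card_image_le

theorem boundaryArea_compl (A : Finset V) : boundaryArea G Aᶜ = boundaryArea G A := by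
  unfold boundaryArea
  rw [compl_compl]
  have : Std.Symm G.Adj := ⟨fun _ _ h => h.symm⟩
  exact Rel.card_interedges_comm _ _

theorem boundaryArea_eq_add {S T : Finset V} (hTS : T ⊆ S)
    (h : ∀ a ∈ T, ∀ b ∈ S \ T, ¬ G.Adj a b) :
    boundaryArea G S = boundaryArea G T + boundaryArea G (S \ T) := by
  unfold boundaryArea
  rw [← Finset.card_union_of_disjoint]
  · congr 1
    ext ⟨a, b⟩
    simp only [Finset.mem_union, SimpleGraph.mem_interedges_iff, Finset.mem_compl,
      Finset.mem_sdiff] at h ⊢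
    have h1 := h a
    have h2 := h b
    have h3 := G.adj_comm a b
    have := @hTS a
    have := @hTS b
    grind
  · rw [Finset.disjoint_left]
    rintro ⟨a, b⟩ h1 h2
    simp only [SimpleGraph.mem_interedges_iff, Finset.mem_sdiff] at h1 h2
    exact h2.1.2 h1.1

theorem logb_two_add_one_le_rpow {c : ℝ} (hc : 0 < c) {n : ℕ} (hn : 1 ≤ n) :
    Real.logb 2 ((n : ℝ) + 1) ≤ (1 + 1 / (c * Real.log 2)) * (n : ℝ) ^ c := by
  have hn' : (1 : ℝ) ≤ n := by exact_mod_cast hn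
  have h2 : 0 < Real.log 2 := Real.log_pos (by norm_num)
  have h1 : Real.log ((n : ℝ) + 1) ≤ Real.log 2 + Real.log n := by
    rw [← Real.log_mul (by norm_num) (by positivity)]
    exact Real.log_le_log (by positivity) (by linarith)
  have h3 : Real.log (n : ℝ) ≤ (n : ℝ) ^ c / c := Real.log_le_rpow_div (by positivity) hc
  have h4 : (1 : ℝ) ≤ (n : ℝ) ^ c := Real.one_le_rpow hn' hc.le
  rw [Real.logb, div_le_iff₀ h2]
  have e : (1 + 1 / (c * Real.log 2)) * (n : ℝ) ^ c * Real.log 2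
      = Real.log 2 * (n : ℝ) ^ c + (n : ℝ) ^ c / c := by
    field_simp
  rw [e]
  nlinarith

theorem IsoperimetricBound.logb_card_add_one_le {c K : ℝ} (hc : 0 < c) (hK : 0 < K)
    (hG : IsoperimetricBound G c K) (S : Finset V) (hS : 2 * S.card ≤ Fintype.card V) :
    Real.logb 2 ((S.card : ℝ) + 1) ≤
      (1 + 1 / (c * Real.log 2)) / K * (boundaryArea G S : ℝ) := by
  have h2 : 0 < Real.log 2 := Real.log_pos (by norm_num)
  induction S using Finset.strongInduction with
  | H S ih =>
    rcases S.eq_empty_or_nonempty with rfl | hne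
    · simp only [Finset.card_empty, Nat.cast_zero, zero_add, Real.logb_one]
      positivity
    obtain ⟨T, hTS, hTn, hTc, hsep⟩ := exists_connected_part G S hne
    have hcard : (S \ T).card + T.card = S.card := Finset.card_sdiff_add_card_eq_card hTS
    have hT : Real.logb 2 ((T.card : ℝ) + 1) ≤
        (1 + 1 / (c * Real.log 2)) / K * (boundaryArea G T : ℝ) := by
      have h1 := hG T hTc (by omega)
      have h3 : ((boundarySpins G T).card : ℝ) ≤ boundaryArea G T := by
        exact_mod_cast card_boundarySpins_le_boundaryArea G T
      calc _ ≤ (1 + 1 / (c * Real.log 2)) * (T.card : ℝ) ^ c :=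
            logb_two_add_one_le_rpow hc hTn.card_pos
        _ = (1 + 1 / (c * Real.log 2)) / K * (K * (T.card : ℝ) ^ c) := by field_simp
        _ ≤ _ := by
            have : 0 ≤ (1 + 1 / (c * Real.log 2)) / K := by positivity
            exact mul_le_mul_of_nonneg_left (h1.trans h3) this
    have hrest := ih (S \ T) (Finset.sdiff_ssubset hTS hTn) (by omega)
    rw [boundaryArea_eq_add G hTS hsep]
    have hle : Real.logb 2 ((S.card : ℝ) + 1) ≤
        Real.logb 2 ((T.card : ℝ) + 1) + Real.logb 2 (((S \ T).card : ℝ) + 1) := by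
      rw [← Real.logb_mul (by positivity) (by positivity), ← hcard]
      apply Real.logb_le_logb_of_le (by norm_num) (by positivity)
      push_cast
      nlinarith [mul_nonneg (Nat.cast_nonneg (α := ℝ) (S \ T).card) (Nat.cast_nonneg T.card)]
    push_cast
    linarith

end Isoperimetry

/-! ### Entropy, Schmidt rank and ensembles -/

theorem vonNeumannEntropy_le_logb {n : Type*} [Fintype n] [DecidableEq n] {σ : Matrix n n ℂ}
    (hσ : σ.IsHermitian) (hpos : ∀ i, 0 ≤ hσ.eigenvalues i) (hsum : ∑ i, hσ.eigenvalues i = 1)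
    {k : ℕ} (hk : σ.rank ≤ k) : vonNeumannEntropy hσ ≤ Real.logb 2 k := by
  classical
  have h2 : 0 < Real.log 2 := Real.log_pos (by norm_num)
  let s := Finset.univ.filter fun i => hσ.eigenvalues i ≠ 0
  have hs : s.card ≤ k := by
    rw [hσ.rank_eq_card_non_zero_eigs, Fintype.card_subtype] at hk
    exact hk
  have hsum' : ∑ i ∈ s, hσ.eigenvalues i = 1 := by
    rw [← hsum]
    exact Finset.sum_filter_ne_zero _
  have hs0 : s.Nonempty := by
    rw [Finset.nonempty_iff_ne_empty]
    intro h
    rw [h] at hsum'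
    simp at hsum'
  have hk0 : (0 : ℝ) < k := by exact_mod_cast hs0.card_pos.trans_le hs
  have key : ∀ i ∈ s, -(hσ.eigenvalues i * Real.log (hσ.eigenvalues i)) ≤
      hσ.eigenvalues i * Real.log k + ((k : ℝ)⁻¹ - hσ.eigenvalues i) := by
    intro i hi
    have hne : hσ.eigenvalues i ≠ 0 := (Finset.mem_filter.1 hi).2
    have hp : 0 < hσ.eigenvalues i := lt_of_le_of_ne (hpos i) hne.symm
    have h := Real.log_le_sub_one_of_pos (x := (hσ.eigenvalues i * k)⁻¹) (by positivity)
    rw [Real.log_inv, Real.log_mul hne hk0.ne'] at h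
    have h' := mul_le_mul_of_nonneg_left h hp.le
    have e : hσ.eigenvalues i * ((hσ.eigenvalues i * k)⁻¹ - 1) =
        (k : ℝ)⁻¹ - hσ.eigenvalues i := by field_simp
    rw [e] at h'
    linarith
  have hlog : ∑ i ∈ s, -(hσ.eigenvalues i * Real.log (hσ.eigenvalues i)) ≤ Real.log k := by
    refine (Finset.sum_le_sum key).trans ?_
    rw [Finset.sum_add_distrib, ← Finset.sum_mul, Finset.sum_sub_distrib, hsum', Finset.sum_const,
      nsmul_eq_mul]
    have : (s.card : ℝ) * (k : ℝ)⁻¹ ≤ 1 := by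
      rw [← div_eq_mul_inv, div_le_one hk0]
      exact_mod_cast hs
    linarith
  have e : vonNeumannEntropy hσ =
      (∑ i ∈ s, -(hσ.eigenvalues i * Real.log (hσ.eigenvalues i))) / Real.log 2 := by
    rw [vonNeumannEntropy, Finset.sum_div, Finset.sum_filter]
    refine Finset.sum_congr rfl fun i _ => ?_
    split_ifs with h
    · rw [Real.logb]; ring
    · simp only [ne_eq, not_not] at h
      simp [h]
  rw [e, Real.logb]
  exact div_le_div_of_nonneg_right hlog h2.le

section Bipartite

variable {V : Type*} [Fintype V] [DecidableEq V]

theorem trace_reducedState (A : Finset V) (ψ : SpinSpace V) :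
    (reducedState A ψ).trace = ((‖ψ‖ ^ 2 : ℝ) : ℂ) := by
  rw [EuclideanSpace.norm_sq_eq, reducedState, Matrix.trace]
  simp only [Matrix.diag_apply, Matrix.mul_apply, Matrix.conjTranspose_apply, coeffMatrix,
    Matrix.of_apply]
  rw [← Fintype.sum_prod_type' (f := fun x y =>
    ψ ((Equiv.piEquivPiSubtypeProd (· ∈ A) (fun _ => Fin 2)).symm (x, y)) *
    star (ψ ((Equiv.piEquivPiSubtypeProd (· ∈ A) (fun _ => Fin 2)).symm (x, y))))]
  rw [Equiv.sum_comp (Equiv.piEquivPiSubtypeProd (· ∈ A) (fun _ => Fin 2)).symm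
    (fun z => ψ z * star (ψ z))]
  push_cast
  exact Finset.sum_congr rfl fun z _ => Complex.mul_conj' _

open scoped ComplexOrder in
theorem entanglementEntropy_le_logb (A : Finset V) {ψ : SpinSpace V} (hψ : ‖ψ‖ = 1) {k : ℕ}
    (hk : (coeffMatrix A ψ).rank ≤ k) : entanglementEntropy A ψ ≤ Real.logb 2 k := by
  have hps : (reducedState A ψ).PosSemidef := Matrix.posSemidef_self_mul_conjTranspose _
  refine vonNeumannEntropy_le_logb _ hps.eigenvalues_nonneg ?_ ?_
  · have h := (reducedState_isHermitian A ψ).trace_eq_sum_eigenvalues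
    rw [trace_reducedState, hψ] at h
    have h' : ((∑ i, (reducedState_isHermitian A ψ).eigenvalues i : ℝ) : ℂ) = ((1 : ℝ) : ℂ) := by
      rw [Complex.ofReal_sum]
      simpa using h.symm
    exact_mod_cast h'
  · exact (Matrix.rank_mul_le_left _ _).trans hk

/-- The maximally mixed state is realized by the uniform ensemble of an orthonormal basis. -/
theorem entanglementOfFormation_maximallyMixed_le (A : Finset V)
    (M : Submodule ℂ (SpinSpace V)) (hM : M ≠ ⊥) {r : ℝ}
    (hr : ∀ ψ ∈ M, ‖ψ‖ = 1 → entanglementEntropy A ψ ≤ r) :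
    entanglementOfFormation A (maximallyMixed M) ≤ (r : EReal) := by
  have : Nontrivial M := Submodule.nontrivial_iff_ne_bot.2 hM
  have hd : 0 < Module.finrank ℂ M := Module.finrank_pos
  have hd' : (Module.finrank ℂ M : ℝ) ≠ 0 := by exact_mod_cast hd.ne'
  let b := stdOrthonormalBasis ℂ M
  have hnorm : ∀ i, ‖(b i : SpinSpace V)‖ = 1 := fun i => b.orthonormal.1 i
  let e : PureEnsemble (maximallyMixed M) :=
    { size := Module.finrank ℂ M
      prob := fun _ => (Module.finrank ℂ M : ℝ)⁻¹
      vec := fun i => b i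
      prob_nonneg := fun _ => by positivity
      sum_prob := by simp [hd']
      norm_vec := hnorm
      mixture := by
        rw [maximallyMixed, b.starProjection_eq_sum_rankOne, ContinuousLinearMap.toLinearMap_sum,
          map_sum, Finset.smul_sum]
        refine Finset.sum_congr rfl fun i _ => ?_
        push_cast
        congr 1
        rw [InnerProductSpace.symm_toEuclideanLin_rankOne]
        ext x y
        simp [pureState, Matrix.vecMulVec_apply] }
  refine (iInf_le _ e).trans (EReal.coe_le_coe_iff.2 ?_)
  calc ∑ i, e.prob i * entanglementEntropy A (e.vec i)
      ≤ ∑ i, e.prob i * r := Finset.sum_le_sum fun i _ =>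
        mul_le_mul_of_nonneg_left (hr _ (b i).2 (hnorm i)) (e.prob_nonneg i)
    _ = r := by rw [← Finset.sum_mul, e.sum_prob, one_mul]

end Bipartite

/-! ### Product operators and symmetric vectors -/

section ProductOp

/-- The operator `⨂_v g_v`. -/
def productOp {S : Type*} [Fintype S] (g : S → Matrix (Fin 2) (Fin 2) ℂ) : SpinOp S :=
  Matrix.of fun x y => ∏ v, g v (x v) (y v)

theorem productOp_mul {S : Type*} [Fintype S] [DecidableEq S]
    (g k : S → Matrix (Fin 2) (Fin 2) ℂ) :
    productOp g * productOp k = productOp fun v => g v * k v := by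
  ext x y
  simp only [productOp, Matrix.mul_apply, Matrix.of_apply, Finset.prod_univ_sum,
    Fintype.piFinset_univ, Finset.prod_mul_distrib]

theorem productOp_one {S : Type*} [Fintype S] [DecidableEq S] :
    productOp (fun _ : S => (1 : Matrix (Fin 2) (Fin 2) ℂ)) = 1 := by
  ext x y
  simp only [productOp, Matrix.of_apply, Matrix.one_apply]
  rw [Finset.prod_ite_zero]
  simp [funext_iff]

variable {V : Type*} [Fintype V] [DecidableEq V]

@[to_additive]
theorem prod_mem_mul_prod_notMem {M : Type*} [CommMonoid M] (A : Finset V) (f : V → M) :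
    (∏ v : {v // v ∈ A}, f v) * ∏ v : {v // v ∉ A}, f v = ∏ v, f v := by
  convert Fintype.prod_subtype_mul_prod_subtype (· ∈ A) f

theorem coeffMatrix_productOp (A : Finset V) (k : V → Matrix (Fin 2) (Fin 2) ℂ)
    (χ : SpinSpace V) :
    coeffMatrix A (WithLp.toLp 2 (productOp k *ᵥ χ.ofLp)) =
      productOp (fun v : {v // v ∈ A} => k v) * coeffMatrix A χ *
        (productOp fun v : {v // v ∉ A} => k v)ᵀ := by
  ext x y
  simp only [Matrix.mul_apply, Finset.sum_mul, Matrix.transpose_apply]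
  rw [Finset.sum_comm, ← Fintype.sum_prod_type']
  simp only [coeffMatrix, Matrix.of_apply, Matrix.mulVec, dotProduct]
  rw [← Equiv.sum_comp (Equiv.piEquivPiSubtypeProd (· ∈ A) (fun _ => Fin 2)).symm]
  refine Finset.sum_congr rfl fun z _ => ?_
  simp only [productOp, Matrix.of_apply]
  rw [← prod_mem_mul_prod_notMem A]
  have h1 : ∀ (x : {v // v ∈ A} → Fin 2) (y : {v // v ∉ A} → Fin 2) (v : {v // v ∈ A}),
      (Equiv.piEquivPiSubtypeProd (· ∈ A) (fun _ => Fin 2)).symm (x, y) v = x v := by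
    intro x y v
    simp [Equiv.piEquivPiSubtypeProd]
  have h2 : ∀ (x : {v // v ∈ A} → Fin 2) (y : {v // v ∉ A} → Fin 2) (v : {v // v ∉ A}),
      (Equiv.piEquivPiSubtypeProd (· ∈ A) (fun _ => Fin 2)).symm (x, y) v = y v := by
    intro x y v
    simp [Equiv.piEquivPiSubtypeProd, v.2]
  obtain ⟨z1, z2⟩ := z
  simp only [h1, h2]
  ring

/-- The number of ones of a configuration. -/
def weight {S : Type*} [Fintype S] (x : S → Fin 2) : ℕ := ∑ v, (x v : ℕ)

theorem weight_le_card {S : Type*} [Fintype S] (x : S → Fin 2) : weight x ≤ Fintype.card S := by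
  unfold weight
  calc ∑ v, (x v : ℕ) ≤ ∑ _v : S, 1 := Finset.sum_le_sum fun v _ => by omega
    _ = _ := by simp

theorem weight_piEquivPiSubtypeProd_symm (A : Finset V) (x : {v // v ∈ A} → Fin 2)
    (y : {v // v ∉ A} → Fin 2) :
    weight ((Equiv.piEquivPiSubtypeProd (· ∈ A) (fun _ => Fin 2)).symm (x, y)) =
      weight x + weight y := by
  unfold weight
  rw [← sum_mem_add_sum_notMem A]
  congr 1
  · refine Finset.sum_congr rfl fun v _ => ?_
    simp [Equiv.piEquivPiSubtypeProd]
  · refine Finset.sum_congr rfl fun v _ => ?_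
    simp [Equiv.piEquivPiSubtypeProd, v.2]

theorem exists_perm_of_weight_eq {V : Type*} [Fintype V] {x y : V → Fin 2}
    (h : weight x = weight y) :
    ∃ σ : Equiv.Perm V, x ∘ σ = y := by
  classical
  have hw : ∀ z : V → Fin 2, weight z = Fintype.card {v // z v = 1} := by
    intro z
    rw [weight, Fintype.card_subtype, Finset.card_filter]
    refine Finset.sum_congr rfl fun v _ => ?_
    generalize z v = i
    fin_cases i <;> simp
  rw [hw, hw] at h
  let e : {v // y v = 1} ≃ {v // x v = 1} := Fintype.equivOfCardEq h.symm
  refine ⟨e.extendSubtype, funext fun v => ?_⟩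
  by_cases hv : y v = 1
  · simpa [hv] using e.extendSubtype_mem v hv
  · have := e.extendSubtype_not_mem v hv
    simp only [Function.comp_apply]
    omega

theorem rank_le_of_eq_comp {m n : Type*} [Fintype m] [Fintype n] {N : ℕ} (X : Matrix m n ℂ)
    (w : m → ℕ) (hw : ∀ i, w i ≤ N) (F : ℕ → n → ℂ) (hX : ∀ i j, X i j = F (w i) j) :
    X.rank ≤ N + 1 := by
  have e : X = (Matrix.of fun i (k : Fin (N + 1)) => if w i = k then (1 : ℂ) else 0) *
      (Matrix.of fun (k : Fin (N + 1)) j => F k j) := by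
    ext i j
    simp only [Matrix.mul_apply, Matrix.of_apply, ite_mul, one_mul, zero_mul]
    rw [Finset.sum_eq_single (⟨w i, by have := hw i; omega⟩ : Fin (N + 1))]
    · simp [hX]
    · intro k _ hk
      rw [if_neg]
      intro h
      exact hk (Fin.ext h.symm)
    · simp
  rw [e]
  refine (Matrix.rank_mul_le_right _ _).trans ?_
  simpa using Matrix.rank_le_card_height (Matrix.of fun (k : Fin (N + 1)) j => F k j)

/-- Permutation symmetric vectors have small Schmidt rank. -/
theorem rank_coeffMatrix_le_of_symmetric (A : Finset V) (χ : SpinSpace V)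
    (hχ : ∀ (σ : Equiv.Perm V) (x : V → Fin 2), χ (x ∘ σ) = χ x) :
    (coeffMatrix A χ).rank ≤ min A.card Aᶜ.card + 1 := by
  classical
  obtain ⟨f, hf⟩ : ∃ f : ℕ → ℂ, ∀ x : V → Fin 2, χ x = f (weight x) := by
    refine ⟨fun n => if h : ∃ x : V → Fin 2, weight x = n then χ h.choose else 0, fun x => ?_⟩
    have h : ∃ y : V → Fin 2, weight y = weight x := ⟨x, rfl⟩
    simp only [h, dif_pos]
    obtain ⟨σ, hσ⟩ := exists_perm_of_weight_eq h.choose_spec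
    rw [← hχ σ h.choose, hσ]
  have hc : ∀ x y, coeffMatrix A χ x y = f (weight x + weight y) := fun x y => by
    rw [coeffMatrix, Matrix.of_apply, hf, weight_piEquivPiSubtypeProd_symm]
  rw [← min_add_add_right]
  refine le_min ?_ ?_
  · refine rank_le_of_eq_comp _ weight (fun x => ?_) (fun n y => f (n + weight y)) hc
    simpa using weight_le_card x
  · rw [← Matrix.rank_transpose]
    refine rank_le_of_eq_comp _ weight (fun x => ?_) (fun n y => f (weight y + n))
      (fun x y => hc y x)
    simpa [Finset.card_compl] using weight_le_card x

end ProductOp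

/-! ### Pair constraints and gauge transformations -/

section Gauge

variable {V : Type*} [Fintype V] [DecidableEq V]

/-- The two-spin functional with coefficients `B` on the spins `a`, `b` annihilates `ψ`. -/
def PairAnnihilates (a b : V) (B : Matrix (Fin 2) (Fin 2) ℂ) (ψ : (V → Fin 2) → ℂ) : Prop :=
  ∀ x : V → Fin 2, ∑ i, ∑ j, B i j * ψ (Function.update (Function.update x a i) b j) = 0

/-- The coefficients of the singlet. -/
def singlet : Matrix (Fin 2) (Fin 2) ℂ := !![0, 1; -1, 0]

theorem isUnit_det_singlet : IsUnit singlet.det := by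
  simp [singlet, Matrix.det_fin_two]

theorem sum_sum_update (a : V) (F : (V → Fin 2) → ℂ) :
    ∑ x, ∑ i, F (Function.update x a i) = 2 * ∑ x, F x := by
  let e : ((V → Fin 2) × Fin 2) ≃ ((V → Fin 2) × Fin 2) :=
    Function.Involutive.toPerm (fun p => (Function.update p.1 a p.2, p.1 a))
      (fun p => by simp)
  rw [← Fintype.sum_prod_type']
  have h := Equiv.sum_comp e fun p => F p.1
  have h' : ∑ p : (V → Fin 2) × Fin 2, F p.1 = 2 * ∑ x, F x := by
    rw [Fintype.sum_prod_type]
    simp [Finset.mul_sum]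
  rw [← h']
  exact h

theorem PairAnnihilates.productOp_mulVec {a b : V} (hab : a ≠ b)
    {g : V → Matrix (Fin 2) (Fin 2) ℂ} {B E : Matrix (Fin 2) (Fin 2) ℂ}
    (hB : B = (g a)ᵀ * E * g b) {ψ : (V → Fin 2) → ℂ} (h : PairAnnihilates a b B ψ) :
    PairAnnihilates a b E (productOp g *ᵥ ψ) := by
  intro z
  let R : (V → Fin 2) → ℂ := fun x => ∏ v ∈ (Finset.univ.erase a).erase b, g v (z v) (x v)
  let F : (V → Fin 2) → ℂ := fun x => R x * B (x a) (x b) * ψ x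
  have hR : ∀ x i j, R (Function.update (Function.update x a i) b j) = R x := by
    intro x i j
    refine Finset.prod_congr rfl fun v hv => ?_
    simp only [Finset.mem_erase] at hv
    rw [Function.update_of_ne hv.1, Function.update_of_ne hv.2.1]
  have hprod : ∀ x i j, ∏ v, g v (Function.update (Function.update z a i) b j v) (x v) =
      g a i (x a) * (g b j (x b) * R x) := by
    intro x i j
    rw [← Finset.mul_prod_erase _ _ (Finset.mem_univ a),
      ← Finset.mul_prod_erase _ _ (Finset.mem_erase.2 ⟨hab.symm, Finset.mem_univ b⟩)]
    rw [Function.update_of_ne hab, Function.update_self, Function.update_self]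
    congr 2
    refine Finset.prod_congr rfl fun v hv => ?_
    simp only [Finset.mem_erase] at hv
    rw [Function.update_of_ne hv.1, Function.update_of_ne hv.2.1]
  have h1 : ∑ i, ∑ j, E i j *
      (productOp g *ᵥ ψ) (Function.update (Function.update z a i) b j) = ∑ x, F x := by
    simp only [Matrix.mulVec, dotProduct, productOp, Matrix.of_apply, hprod, Finset.mul_sum]
    simp only [Fin.sum_univ_two, ← Finset.sum_add_distrib]
    refine Finset.sum_congr rfl fun x _ => ?_
    simp only [F, hB, Matrix.mul_apply, Fin.sum_univ_two, Matrix.transpose_apply]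
    ring
  have h2 : (2 : ℂ) * (2 * ∑ x, F x) = 0 := by
    rw [← sum_sum_update b F, ← sum_sum_update a (fun x => ∑ j, F (Function.update x b j))]
    refine Finset.sum_eq_zero fun x _ => ?_
    have := h x
    simp only [F, hR, Function.update_self, Function.update_of_ne hab, mul_assoc]
    simp only [← Finset.mul_sum]
    rw [this, mul_zero]
  rw [h1]
  simpa using h2

theorem PairAnnihilates.apply_comp_swap {V : Type*} [DecidableEq V] {a b : V} (hab : a ≠ b)
    {χ : (V → Fin 2) → ℂ}
    (h : PairAnnihilates a b singlet χ) (x : V → Fin 2) : χ (x ∘ Equiv.swap a b) = χ x := by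
  have key : ∀ i j, χ (Function.update (Function.update x a i) b j) =
      χ (Function.update (Function.update x a j) b i) := by
    have h' := h x
    simp only [singlet, Fin.sum_univ_two, Matrix.of_apply, Matrix.cons_val_zero,
      Matrix.cons_val_one, Matrix.cons_val', zero_mul, one_mul, zero_add, neg_mul,
      add_zero] at h'
    have h'' := add_neg_eq_zero.1 h'
    intro i j
    fin_cases i <;> fin_cases j
    · rfl
    · exact h''
    · exact h''.symm
    · rfl
  have e1 : Function.update (Function.update x a (x a)) b (x b) = x := by simp
  have e2 : Function.update (Function.update x a (x b)) b (x a) = x ∘ Equiv.swap a b := by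
    funext v
    by_cases hb : v = b
    · subst hb; simp
    by_cases ha : v = a
    · subst ha; simp [hab]
    · simp [ha, hb, Equiv.swap_apply_of_ne_of_ne ha hb]
  rw [← e2, ← key, e1]

/-- A connected graph has a root and a parent function along which a rank decreases. -/
theorem exists_parent {V : Type*} {G : SimpleGraph V} (hG : G.Connected) :
    ∃ (r : V) (p : V → V) (d : V → ℕ), ∀ v, v ≠ r → G.Adj (p v) v ∧ d (p v) < d v := by
  obtain ⟨r⟩ := hG.nonempty
  have h : ∀ v, ∃ w, v ≠ r → G.Adj w v ∧ G.dist w r < G.dist v r := by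
    intro v
    obtain ⟨q, hq⟩ := hG.exists_walk_length_eq_dist v r
    cases q with
    | nil => exact ⟨r, fun hv => absurd rfl hv⟩
    | cons hadj q' =>
      refine ⟨_, fun _ => ⟨hadj.symm, ?_⟩⟩
      have := SimpleGraph.dist_le q'
      rw [SimpleGraph.Walk.length_cons] at hq
      omega
  choose p hp using h
  exact ⟨r, p, fun v => G.dist v r, hp⟩

/-- Nondegenerate pair constraints become singlets along the edges of a rooted tree after an
invertible change of basis of every spin. -/
theorem exists_gauge {V : Type*} [DecidableEq V] {r : V} {p : V → V} {d : V → ℕ}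
    (hd : ∀ v, v ≠ r → d (p v) < d v)
    (B : V → Matrix (Fin 2) (Fin 2) ℂ) (hB : ∀ v, v ≠ r → IsUnit (B v).det) :
    ∃ g : V → Matrix (Fin 2) (Fin 2) ℂ, (∀ v, IsUnit (g v).det) ∧
      ∀ v, v ≠ r → B v = (g (p v))ᵀ * singlet * g v := by
  let T : (v : V) → ((w : V) → d w < d v → Matrix (Fin 2) (Fin 2) ℂ) →
      Matrix (Fin 2) (Fin 2) ℂ := fun v ih =>
    if h : v = r then 1 else ((ih (p v) (hd v h))ᵀ * singlet)⁻¹ * B v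
  let wf : WellFounded fun w v => d w < d v := (measure d).wf
  let g := wf.fix T
  have hg : ∀ v, g v = if v = r then 1 else ((g (p v))ᵀ * singlet)⁻¹ * B v := by
    intro v
    have := wf.fix_eq T v
    simp only [T] at this
    by_cases h : v = r
    · rw [if_pos h]; rw [dif_pos h] at this; exact this
    · rw [if_neg h]; rw [dif_neg h] at this; exact this
  have hunit : ∀ v, IsUnit (g v).det := by
    intro v
    induction v using wf.induction with
    | _ v ih =>
      rw [hg]
      split_ifs with h
      · simp
      · rw [Matrix.det_mul]
        refine IsUnit.mul (Matrix.isUnit_nonsing_inv_det _ ?_) (hB v h)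
        rw [Matrix.det_mul, Matrix.det_transpose]
        exact (ih _ (hd v h)).mul isUnit_det_singlet
  refine ⟨g, hunit, fun v h => ?_⟩
  have hu : IsUnit ((g (p v))ᵀ * singlet).det := by
    rw [Matrix.det_mul, Matrix.det_transpose]
    exact (hunit _).mul isUnit_det_singlet
  rw [hg v, if_neg h, ← mul_assoc, Matrix.mul_nonsing_inv _ hu, one_mul]

theorem mem_of_swap_parent_mem {r : V} {p : V → V} {d : V → ℕ}
    (hd : ∀ v, v ≠ r → d (p v) < d v) (N : Submonoid (Equiv.Perm V))
    (hN : ∀ v, v ≠ r → Equiv.swap (p v) v ∈ N) (σ : Equiv.Perm V) : σ ∈ N := by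
  let wf : WellFounded fun w v => d w < d v := (measure d).wf
  have hr : ∀ v, Equiv.swap r v ∈ N := by
    intro v
    induction v using wf.induction with
    | _ v ih =>
      by_cases h : v = r
      · subst h; simp only [Equiv.swap_self]; exact N.one_mem
      · exact SubmonoidClass.swap_mem_trans N (ih _ (hd v h)) (hN v h)
  induction σ using Equiv.Perm.swap_induction_on with
  | one => exact N.one_mem
  | swap_mul f x y hxy ih =>
    refine N.mul_mem (SubmonoidClass.swap_mem_trans N ?_ (hr y)) ih
    rw [Equiv.swap_comm]
    exact hr x

/-- A vector annihilated by a nondegenerate pair functional on every edge of a connected graph has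
small Schmidt rank. -/
theorem rank_coeffMatrix_le_of_pairAnnihilates {G : SimpleGraph V} (hG : G.Connected)
    (ψ : SpinSpace V)
    (h : ∀ a b, G.Adj a b → ∃ B : Matrix (Fin 2) (Fin 2) ℂ, IsUnit B.det ∧
      PairAnnihilates a b B ψ.ofLp) (A : Finset V) :
    (coeffMatrix A ψ).rank ≤ min A.card Aᶜ.card + 1 := by
  obtain ⟨r, p, d, hp⟩ := exists_parent hG
  have h' : ∀ v, ∃ B : Matrix (Fin 2) (Fin 2) ℂ, v ≠ r →
      IsUnit B.det ∧ PairAnnihilates (p v) v B ψ.ofLp := by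
    intro v
    by_cases hv : v = r
    · exact ⟨0, fun h => absurd hv h⟩
    · obtain ⟨B, hB⟩ := h _ _ (hp v hv).1
      exact ⟨B, fun _ => hB⟩
  choose B hB using h'
  obtain ⟨g, hg, hgB⟩ := exists_gauge (fun v hv => (hp v hv).2) B (fun v hv => (hB v hv).1)
  let χ : SpinSpace V := WithLp.toLp 2 (productOp g *ᵥ ψ.ofLp)
  let N : Submonoid (Equiv.Perm V) :=
    { carrier := {σ | ∀ x : V → Fin 2, χ (x ∘ σ) = χ x}
      one_mem' := fun x => rfl
      mul_mem' := fun {σ τ} hσ hτ x => by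
        rw [Equiv.Perm.coe_mul, ← Function.comp_assoc, hτ, hσ] }
  have hN : ∀ σ, σ ∈ N := mem_of_swap_parent_mem (fun v hv => (hp v hv).2) N fun v hv x =>
    ((hB v hv).2.productOp_mulVec (hp v hv).1.ne (hgB v hv)).apply_comp_swap (hp v hv).1.ne x
  have hψ : ψ = WithLp.toLp 2 (productOp (fun v => (g v)⁻¹) *ᵥ χ.ofLp) := by
    have e : (fun v => (g v)⁻¹ * g v) = fun _ => 1 :=
      funext fun v => Matrix.nonsing_inv_mul _ (hg v)
    simp only [χ]
    rw [Matrix.mulVec_mulVec, productOp_mul, e, productOp_one, Matrix.one_mulVec]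
  rw [hψ, coeffMatrix_productOp]
  exact (Matrix.rank_mul_le_left _ _).trans ((Matrix.rank_mul_le_right _ _).trans
    (rank_coeffMatrix_le_of_symmetric A χ hN))

end Gauge

/-! ### Ground spaces -/

section GroundSpace

variable {n : Type*} [Fintype n] [DecidableEq n]

theorem mem_spectrum_real_iff_hasEigenvalue (X : Matrix n n ℂ) (E : ℝ) :
    E ∈ spectrum ℝ X ↔ Module.End.HasEigenvalue (Matrix.toEuclideanLin X) (E : ℂ) := by
  rw [Module.End.hasEigenvalue_iff_mem_spectrum, Matrix.spectrum_toLpLin]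
  exact (spectrum.algebraMap_mem_iff ℂ).symm

theorem mem_eigenspace_toEuclideanLin (X : Matrix n n ℂ) (E : ℂ) (ψ : EuclideanSpace ℂ n) :
    ψ ∈ Module.End.eigenspace (Matrix.toEuclideanLin X) E ↔ X *ᵥ ψ.ofLp = E • ψ.ofLp := by
  rw [Module.End.mem_eigenspace_iff, Matrix.toLpLin_apply]
  constructor
  · intro h
    simpa using congrArg WithLp.ofLp h
  · intro h
    rw [h]
    rfl

theorem groundEnergy_mem_spectrum [Nonempty n] {X : Matrix n n ℂ} (hX : X.IsHermitian) :
    groundEnergy X ∈ spectrum ℝ X := by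
  refine Set.Nonempty.csInf_mem ?_ Matrix.finite_real_spectrum
  rw [hX.spectrum_real_eq_range_eigenvalues]
  exact Set.range_nonempty _

theorem groundSpace_ne_bot [Nonempty n] {X : Matrix n n ℂ} (hX : X.IsHermitian) :
    groundSpace X ≠ ⊥ :=
  (mem_spectrum_real_iff_hasEigenvalue X _).1 (groundEnergy_mem_spectrum hX)

theorem groundEnergy_le_of_mulVec {X : Matrix n n ℂ} {E : ℝ} {ψ : n → ℂ} (hψ : ψ ≠ 0)
    (h : X *ᵥ ψ = (E : ℂ) • ψ) : groundEnergy X ≤ E := by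
  refine csInf_le Matrix.finite_real_spectrum.bddBelow
    ((mem_spectrum_real_iff_hasEigenvalue X E).2 ?_)
  refine Module.End.hasEigenvalue_of_hasEigenvector (x := WithLp.toLp 2 ψ) ⟨?_, ?_⟩
  · exact (mem_eigenspace_toEuclideanLin X _ _).2 h
  · simpa using hψ

end GroundSpace

/-! ### Two-spin terms -/

section ExtendPair

variable {V : Type*} [Fintype V] [DecidableEq V]

/-- The configuration that agrees with `u` on the pair `e` and with `x` elsewhere. -/
def overridePair (e : Sym2 V) (x : V → Fin 2) (u : {v // v ∈ e} → Fin 2) : V → Fin 2 :=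
  fun v => if h : v ∈ e then u ⟨v, h⟩ else x v

theorem overridePair_restrict {V : Type*} [DecidableEq V] (e : Sym2 V) (x : V → Fin 2)
    (u : {v // v ∈ e} → Fin 2) :
    (fun v : {v // v ∈ e} => overridePair e x u v) = u := by
  funext v
  simp [overridePair, v.2]

theorem overridePair_overridePair {V : Type*} [DecidableEq V] (e : Sym2 V) (x : V → Fin 2)
    (u w : {v // v ∈ e} → Fin 2) :
    overridePair e (overridePair e x u) w = overridePair e x w := by
  funext v
  by_cases h : v ∈ e <;> simp [overridePair, h]

theorem extendPair_mulVec (e : Sym2 V) (h : SpinOp {v // v ∈ e}) (ψ : (V → Fin 2) → ℂ)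
    (x : V → Fin 2) :
    (extendPair e h *ᵥ ψ) x = ∑ u, h (fun v => x v) u * ψ (overridePair e x u) := by
  simp only [Matrix.mulVec, dotProduct, extendPair, Matrix.of_apply, ite_mul, zero_mul]
  rw [← Finset.sum_filter]
  refine Finset.sum_nbij' (fun y v => y v) (overridePair e x) (fun _ _ => Finset.mem_univ _)
    ?_ ?_ (fun u _ => overridePair_restrict e x u) ?_
  · intro u _
    refine Finset.mem_filter.2 ⟨Finset.mem_univ _, fun v hv => ?_⟩
    simp [overridePair, hv]
  all_goals
    intro y hy
    have e1 : overridePair e x (fun v => y v) = y := by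
      funext v
      by_cases hv : v ∈ e
      · simp [overridePair, hv]
      · simp [overridePair, hv, (Finset.mem_filter.1 hy).2 v hv]
    simp only [e1]

theorem extendPair_isHermitian {e : Sym2 V} {h : SpinOp {v // v ∈ e}} (hh : h.IsHermitian) :
    (extendPair e h).IsHermitian := by
  ext x y
  have hc : (∀ v, v ∉ e → y v = x v) ↔ ∀ v, v ∉ e → x v = y v :=
    forall₂_congr fun _ _ => eq_comm
  simp only [extendPair, Matrix.conjTranspose_apply, Matrix.of_apply, hc]
  split_ifs
  · exact hh.apply _ _
  · simp

theorem groundEnergy_extendPair_le (e : Sym2 V) {h : SpinOp {v // v ∈ e}} (hh : h.IsHermitian) :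
    groundEnergy (extendPair e h) ≤ groundEnergy h := by
  obtain ⟨φ, hφ, hφ0⟩ := (groundSpace h).ne_bot_iff.1 (groundSpace_ne_bot hh)
  have hφ' := (mem_eigenspace_toEuclideanLin _ _ _).1 hφ
  refine groundEnergy_le_of_mulVec (ψ := fun x : V → Fin 2 => φ fun v => x v) ?_ ?_
  · contrapose! hφ0
    ext u
    have := congrFun hφ0 (overridePair e 0 u)
    rw [overridePair_restrict] at this
    simpa using this
  · funext x
    rw [extendPair_mulVec]
    simp only [overridePair_restrict]
    exact congrFun hφ' fun v => x v

/-- The slices of a ground state vector of `h ⊗ 1` are ground state vectors of `h`. -/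
theorem slice_mem_groundSpace {e : Sym2 V} {h : SpinOp {v // v ∈ e}} (hh : h.IsHermitian)
    {ψ : SpinSpace V} (hψ : ψ ∈ groundSpace (extendPair e h)) (x : V → Fin 2) :
    WithLp.toLp 2 (fun u => ψ (overridePair e x u)) ∈ groundSpace h := by
  have hψ' := (mem_eigenspace_toEuclideanLin _ _ _).1 hψ
  have hs : h *ᵥ (fun u => ψ (overridePair e x u)) =
      ((groundEnergy (extendPair e h) : ℝ) : ℂ) • fun u => ψ (overridePair e x u) := by
    funext u
    have := congrFun hψ' (overridePair e x u)
    rw [extendPair_mulVec, overridePair_restrict] at this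
    simp only [overridePair_overridePair] at this
    exact this
  by_cases h0 : (fun u => ψ (overridePair e x u)) = 0
  · rw [h0]
    exact Submodule.zero_mem _
  · have hE : groundEnergy (extendPair e h) = groundEnergy h :=
      le_antisymm (groundEnergy_extendPair_le e hh) (groundEnergy_le_of_mulVec h0 hs)
    rw [hE] at hs
    exact (mem_eigenspace_toEuclideanLin _ _ _).2 hs

/-- Configurations of the two spins of the pair `s(a, b)`. -/
def pairConfigEquiv {a b : V} (hab : a ≠ b) :
    (Fin 2 × Fin 2) ≃ ({v // v ∈ s(a, b)} → Fin 2) where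
  toFun ij v := if (v : V) = a then ij.1 else ij.2
  invFun w := (w ⟨a, Sym2.mem_mk_left a b⟩, w ⟨b, Sym2.mem_mk_right a b⟩)
  left_inv ij := by simp [hab.symm]
  right_inv w := by
    funext ⟨v, hv⟩
    rcases Sym2.mem_iff.1 hv with rfl | rfl
    · simp
    · simp [hab.symm]

theorem overridePair_pairConfigEquiv {V : Type*} [DecidableEq V] {a b : V} (hab : a ≠ b)
    (x : V → Fin 2) (i j : Fin 2) :
    overridePair s(a, b) x (pairConfigEquiv hab (i, j)) =
      Function.update (Function.update x a i) b j := by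
  funext v
  by_cases hb : v = b
  · subst hb
    simp [overridePair, pairConfigEquiv, hab.symm]
  by_cases ha : v = a
  · subst ha
    simp [overridePair, pairConfigEquiv, hab]
  · simp [overridePair, ha, hb]

theorem exists_eq_mul_of_det_eq_zero {k : Type*} [Field k] (X : Matrix (Fin 2) (Fin 2) k)
    (h : X.det = 0) : ∃ u w : Fin 2 → k, ∀ i j, X i j = u i * w j := by
  rw [Matrix.det_fin_two, sub_eq_zero] at h
  by_cases h00 : X 0 0 = 0
  · rw [h00, zero_mul] at h
    rcases mul_eq_zero.1 h.symm with h01 | h10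
    · refine ⟨![0, 1], X 1, fun i j => ?_⟩
      fin_cases i <;> fin_cases j <;> simp [h00, h01]
    · refine ⟨fun i => X i 1, ![0, 1], fun i j => ?_⟩
      fin_cases i <;> fin_cases j <;> simp [h00, h10]
  · refine ⟨fun i => X i 0, fun j => X 0 j / X 0 0, fun i j => ?_⟩
    fin_cases i <;> fin_cases j
    · simp [h00]
    · simp only [Fin.zero_eta, Fin.mk_one]; field_simp
    · simp [h00]
    · simp only [Fin.mk_one]; field_simp; linear_combination h

theorem det_pair_ne_zero_of_not_isProductVector {a b : V} (hab : a ≠ b)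
    {φ : SpinSpace {v // v ∈ s(a, b)}} (hφ : ¬ IsProductVector φ) :
    (Matrix.of fun i j => φ (pairConfigEquiv hab (i, j))).det ≠ 0 := by
  intro h
  obtain ⟨u, w, huw⟩ := exists_eq_mul_of_det_eq_zero _ h
  refine hφ ⟨fun v => if (v : V) = a then u else w, fun x => ?_⟩
  obtain ⟨⟨i, j⟩, rfl⟩ := (pairConfigEquiv hab).surjective x
  have huniv : (Finset.univ : Finset {v // v ∈ s(a, b)}) =
      {⟨a, Sym2.mem_mk_left a b⟩, ⟨b, Sym2.mem_mk_right a b⟩} := by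
    ext ⟨v, hv⟩
    simpa using hv
  rw [huniv, Finset.prod_pair (by simpa using hab)]
  have := huw i j
  rw [Matrix.of_apply] at this
  rw [this]
  simp [pairConfigEquiv, hab.symm]

theorem pairAnnihilates_of_mem_orthogonal {a b : V} (hab : a ≠ b) {h : SpinOp {v // v ∈ s(a, b)}}
    (hh : h.IsHermitian) {φ : SpinSpace {v // v ∈ s(a, b)}} (hφ : φ ∈ (groundSpace h)ᗮ)
    {ψ : SpinSpace V} (hψ : ψ ∈ groundSpace (extendPair s(a, b) h)) :
    PairAnnihilates a b (Matrix.of fun i j => star (φ (pairConfigEquiv hab (i, j)))) ψ.ofLp := by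
  intro x
  have h0 := (Submodule.mem_orthogonal' _ _).1 hφ _ (slice_mem_groundSpace hh hψ x)
  rw [PiLp.inner_apply, ← Equiv.sum_comp (pairConfigEquiv hab), Fintype.sum_prod_type] at h0
  rw [← h0]
  refine Finset.sum_congr rfl fun i _ => Finset.sum_congr rfl fun j _ => ?_
  rw [← overridePair_pairConfigEquiv hab]
  simp [mul_comm]

end ExtendPair

/-! ### Ground states of natural unfrustrated Hamiltonians -/

namespace PairHamiltonian

variable {V : Type*} [Fintype V] [DecidableEq V] {G : SimpleGraph V} [DecidableRel G.Adj]

theorem total_isHermitian (H : PairHamiltonian G) : H.total.IsHermitian := by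
  unfold total
  rw [Matrix.IsHermitian, Matrix.conjTranspose_sum]
  exact Finset.sum_congr rfl fun e _ => extendPair_isHermitian (H.isHermitian e)

theorem rank_coeffMatrix_le (H : PairHamiltonian G) (hn : H.IsNatural) (hu : H.IsUnfrustrated)
    {ψ : SpinSpace V} (hψ : ψ ∈ groundSpace H.total) (A : Finset V) :
    (coeffMatrix A ψ).rank ≤ min A.card Aᶜ.card + 1 := by
  refine rank_coeffMatrix_le_of_pairAnnihilates hn.connected ψ (fun a b hab => ?_) A
  let e : G.edgeSet := ⟨s(a, b), hab⟩
  obtain ⟨φ, hφ, hent⟩ := hn.entangled e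
  refine ⟨_, ?_, pairAnnihilates_of_mem_orthogonal hab.ne (H.isHermitian e) hφ (hu e hψ)⟩
  have h := det_pair_ne_zero_of_not_isProductVector hab.ne hent
  rw [isUnit_iff_ne_zero]
  intro h0
  apply h
  rw [Matrix.det_fin_two] at h0 ⊢
  simp only [Matrix.of_apply, ← star_mul', ← star_sub] at h0 ⊢
  exact star_eq_zero.1 h0

theorem entanglementEntropy_le (H : PairHamiltonian G) (hn : H.IsNatural) (hu : H.IsUnfrustrated)
    {ψ : SpinSpace V} (hψ : ψ ∈ groundSpace H.total) (hψ1 : ‖ψ‖ = 1) (A : Finset V) :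
    entanglementEntropy A ψ ≤ Real.logb 2 ((min A.card Aᶜ.card : ℕ) + 1) := by
  have h := entanglementEntropy_le_logb A hψ1 (H.rank_coeffMatrix_le hn hu hψ A)
  rwa [Nat.cast_add_one] at h

end PairHamiltonian

theorem IsoperimetricBound.logb_min_card_add_one_le {V : Type*} [Fintype V] [DecidableEq V]
    {G : SimpleGraph V} [DecidableRel G.Adj] {c K : ℝ} (hc : 0 < c) (hK : 0 < K)
    (hG : IsoperimetricBound G c K) (A : Finset V) :
    Real.logb 2 ((min A.card Aᶜ.card : ℕ) + 1) ≤
      (1 + 1 / (c * Real.log 2)) / K * (boundaryArea G A : ℝ) := by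
  have hcard := A.card_add_card_compl
  rcases le_total A.card Aᶜ.card with h | h
  · rw [min_eq_left h]
    exact hG.logb_card_add_one_le G hc hK A (by omega)
  · rw [min_eq_right h, ← boundaryArea_compl]
    exact hG.logb_card_add_one_le G hc hK Aᶜ (by omega)

end SpinLattice

theorem mainTheorem1 (c K : ℝ) (hc : 0 < c) (hK : 0 < K) :
    ∃ C : ℝ, 0 < C ∧
      ∀ (V : Type*) [Fintype V] [DecidableEq V] (G : SimpleGraph V) [DecidableRel G.Adj],
        SpinLattice.IsoperimetricBound G c K →
        ∀ H : SpinLattice.PairHamiltonian G, H.IsNatural → H.IsUnfrustrated →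
          ∀ A : Finset V,
            SpinLattice.entanglementOfFormation A H.groundState ≤
              ((C * (SpinLattice.boundaryArea G A : ℝ) : ℝ) : EReal) := by
  have h2 : 0 < Real.log 2 := Real.log_pos (by norm_num)
  refine ⟨(1 + 1 / (c * Real.log 2)) / K, by positivity, ?_⟩
  intro V _ _ G _ hG H hn hu A
  exact SpinLattice.entanglementOfFormation_maximallyMixed_le A _
    (SpinLattice.groundSpace_ne_bot H.total_isHermitian) fun ψ hψ hψ1 =>
      (H.entanglementEntropy_le hn hu hψ hψ1 A).trans (hG.logb_min_card_add_one_le hc hK A)
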